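/- Let \(R\) be a commutative ring, \(H\) a Hopf algebra over \(R\) which is flat as an \(R\)-module, and \(A\) a right \(H\)-comodule algebra with coaction \(b\mapsto b_{(0)}\otimes b_{(1)}\in A\otimes_R H\). Put \(B=A^{co\,H}=\{a\in A: a_{(0)}\otimes a_{(1)}=a\otimes 1\}\). Assume that \(A/B\) is an \(H\)-crossed product, i.e. \(A\cong B\#_\sigma H\) as \(H\)-comodule algebras for some measuring of \(B\) by \(H\) and some normalised convolution invertible cocycle \(\sigma:H\otimes_R H\to B\) that makes \(B\) a twisted \(H\)-module, and that \(B\) is a faithfully flat Mittag--Leffler \(R\)-module. A generalised quotient of \(H\) is a quotient \(\pi_Q:H\to Q=H/I\) by a right ideal coideal \(I\); these form a complete lattice, where \(H/I\le H/J\) iff \(J\subseteq I\). Put \(A^{co\,Q}=\{a\in A: a_{(0)}\otimes\pi_Q(a_{(1)})=a\otimes\pi_Q(1)\}\). For a subalgebra \(S\) of \(A\) put \(\psi(S)=\bigvee\{Q: S\subseteq A^{co\,Q}\}\), and call \(S\) closed if \(S=A^{co\,\psi(S)}\). Let \(A\square_Q H\) be the set of all \(x\in A\otimes_R H\) at which the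 two maps \(A\otimes_R H\to A\otimes_R Q\otimes_R H\) induced by \(a\mapsto a_{(0)}\otimes\pi_Q(a_{(1)})\) and \(h\mapsto \pi_Q(h_{(1)})\otimes h_{(2)}\) agree. Theorem. Let \(S\) be a subalgebra with \(B\subseteq S\subseteq A\). Then \(S\) is closed if and only if the canonical map \[\mathit{can}_S: S\otimes_B A\to A\otimes_R H,\qquad a\otimes b\mapsto ab_{(0)}\otimes b_{(1)},\] is an isomorphism onto \(A\square_{\psi(S)}H\), i.e. is injective with image \(A\square_{\psi(S)}H\). -/

import Mathlib

open scoped TensorProduct Coalgebra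

universe u v w w'

namespace HopfGalois

/-- A module `M` over `R` is Mittag-Leffler if for every family `(N i)` of `R`-modules the
canonical map `M ⊗ (∏ N i) → ∏ (M ⊗ N i)` is injective.  It is enough to test families that live
in the universe of `R` (the general case reduces to families, indexed by submodules of the `R ^ n`,
of finitely generated modules). -/
def IsMittagLeffler (R : Type u) (M : Type v) [CommRing R] [AddCommGroup M] [Module R M] : Prop :=
  ∀ (ι : Type u) (N : ι → Type u) [∀ i, AddCommGroup (N i)] [∀ i, Module R (N i)],
    Function.Injective (TensorProduct.piRightHom R R M N)

/-- A right `H`-comodule algebra: an `R`-algebra `A` with a coassociative and counital coaction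
`δ : A → A ⊗ H` which is an algebra homomorphism. -/
class ComoduleAlgebra (R : Type u) (H : Type v) (A : Type w) [CommRing R] [Ring H]
    [HopfAlgebra R H] [Ring A] [Algebra R A] where
  /-- the coaction `a ↦ a₍₀₎ ⊗ a₍₁₎` -/
  coact : A →ₐ[R] A ⊗[R] H
  coassoc : ∀ a : A,
    TensorProduct.assoc R A H H (coact.toLinearMap.rTensor H (coact a)) =
      (Coalgebra.comul (R := R) (A := H)).lTensor A (coact a)
  counit : ∀ a : A,
    TensorProduct.rid R A ((Coalgebra.counit (R := R) (A := H)).lTensor A (coact a)) = a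

/-- A generalised quotient `Q = H / ker` of `H`: a quotient by a right ideal coideal. -/
@[ext]
structure GenQuot (R : Type u) (H : Type v) [CommRing R] [Ring H] [HopfAlgebra R H] where
  /-- the right ideal coideal `I` with `Q = H / I` -/
  ker : Submodule R H
  isCoideal : ker.IsCoideal
  mul_mem : ∀ x ∈ ker, ∀ h : H, x * h ∈ ker

namespace GenQuot

variable {R : Type u} {H : Type v} [CommRing R] [Ring H] [HopfAlgebra R H]

/-- The underlying `R`-module `H / I` of a generalised quotient. -/
abbrev Carrier (Q : GenQuot R H) : Type v := H ⧸ Q.ker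

/-- The projection `π_Q : H → Q`. -/
abbrev proj (Q : GenQuot R H) : H →ₗ[R] Q.Carrier := Q.ker.mkQ

/-- `Q₁ ≤ Q₂` if and only if `Q₁` is a quotient of `Q₂`. -/
instance : PartialOrder (GenQuot R H) where
  le Q₁ Q₂ := Q₂.ker ≤ Q₁.ker
  le_refl _ := le_rfl
  le_trans _ _ _ h₁ h₂ := le_trans h₂ h₁
  le_antisymm _ _ h₁ h₂ := GenQuot.ext (le_antisymm h₂ h₁)

theorem le_def (Q₁ Q₂ : GenQuot R H) : Q₁ ≤ Q₂ ↔ Q₂.ker ≤ Q₁.ker := Iff.rfl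

/-- The infimum of a set of generalised quotients is the quotient by the sum of the kernels. -/
instance : InfSet (GenQuot R H) where
  sInf s :=
    { ker := ⨆ Q ∈ s, Q.ker
      isCoideal := by
        rw [Submodule.isCoideal_iff_comul_mem]
        have key : ∀ Q ∈ s, Q.ker ≤ ⨆ Q ∈ s, Q.ker := fun Q hQ => le_iSup₂_of_le Q hQ le_rfl
        constructor
        · have h : (⨆ Q ∈ s, Q.ker) ≤ LinearMap.ker (Coalgebra.counit (R := R) (A := H)) :=
            iSup₂_le fun Q _ x hx => Q.isCoideal.counit_eq_zero hx
          exact fun x hx => h hx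
        · have h : (⨆ Q ∈ s, Q.ker) ≤
              (LinearMap.range ((⨆ Q ∈ s, Q.ker).subtype.lTensor H) ⊔
                LinearMap.range ((⨆ Q ∈ s, Q.ker).subtype.rTensor H)).comap
                  (Coalgebra.comul (R := R) (A := H)) := by
            refine iSup₂_le fun Q hQ x hx => ?_
            have h₁ := ((Submodule.isCoideal_iff_comul_mem Q.ker).1 Q.isCoideal).2 x hx
            refine (sup_le_sup ?_ ?_ :
              LinearMap.range (Q.ker.subtype.lTensor H) ⊔
                LinearMap.range (Q.ker.subtype.rTensor H) ≤ _) h₁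
            · rintro _ ⟨y, rfl⟩
              refine ⟨(Submodule.inclusion (key Q hQ)).lTensor H y, ?_⟩
              rw [← LinearMap.comp_apply, ← LinearMap.lTensor_comp]
              rfl
            · rintro _ ⟨y, rfl⟩
              refine ⟨(Submodule.inclusion (key Q hQ)).rTensor H y, ?_⟩
              rw [← LinearMap.comp_apply, ← LinearMap.rTensor_comp]
              rfl
          exact fun x hx => h hx
      mul_mem := by
        intro x hx h
        have hle : (⨆ Q ∈ s, Q.ker) ≤
            (⨆ Q ∈ s, Q.ker).comap (LinearMap.mulRight R h) :=
          iSup₂_le fun Q hQ y hy =>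
            (le_iSup₂_of_le Q hQ le_rfl : Q.ker ≤ ⨆ Q ∈ s, Q.ker) (Q.mul_mem y hy h)
        exact hle hx }

/-- The poset of generalised quotients is a complete lattice. -/
instance : CompleteLattice (GenQuot R H) :=
  completeLatticeOfInf _ fun s =>
    ⟨fun Q hQ => (le_iSup₂_of_le Q hQ le_rfl : Q.ker ≤ ⨆ Q ∈ s, Q.ker),
      fun P hP => show (⨆ Q ∈ s, Q.ker) ≤ P.ker from iSup₂_le fun _ hQ => hP hQ⟩

end GenQuot

/-- Since the kernel of `π_Q` is a right ideal, `id ⊗ π_Q` is right `A ⊗ H`-linear. -/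
theorem lTensor_proj_mul {R : Type u} {H : Type v} {A : Type w} [CommRing R] [Ring H]
    [HopfAlgebra R H] [Ring A] [Algebra R A] (Q : GenQuot R H) (x y z : A ⊗[R] H)
    (h : Q.proj.lTensor A x = Q.proj.lTensor A y) :
    Q.proj.lTensor A (x * z) = Q.proj.lTensor A (y * z) := by
  rw [← sub_eq_zero, ← map_sub, ← sub_mul]
  rw [← sub_eq_zero, ← map_sub] at h
  have hx : x - y ∈ LinearMap.range (Q.ker.subtype.lTensor A) := by
    rw [← lTensor_mkQ]; exact h
  obtain ⟨t, ht⟩ := hx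
  rw [← ht]
  clear ht h
  induction t with
  | zero => simp
  | add t₁ t₂ h₁ h₂ => rw [map_add, add_mul, map_add, h₁, h₂, add_zero]
  | tmul a i =>
    induction z with
    | zero => simp
    | add z₁ z₂ h₁ h₂ => rw [mul_add, map_add, h₁, h₂, add_zero]
    | tmul b k =>
      have : Q.proj ((i : H) * k) = 0 :=
        (Submodule.Quotient.mk_eq_zero _).2 (Q.mul_mem _ i.2 k)
      simp only [LinearMap.lTensor_tmul, Submodule.subtype_apply,
        Algebra.TensorProduct.tmul_mul_tmul, this, TensorProduct.tmul_zero]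

section Coinvariants

variable (R : Type u) (H : Type v) (A : Type w) [CommRing R] [Ring H] [HopfAlgebra R H]
  [Ring A] [Algebra R A] [ComoduleAlgebra R H A]

/-- The subalgebra `A^{co H} = {a | δ(a) = a ⊗ 1}` of coinvariants. -/
def coinvariants : Subalgebra R A :=
  AlgHom.equalizer (ComoduleAlgebra.coact (R := R) (H := H) (A := A))
    (Algebra.TensorProduct.includeLeft : A →ₐ[R] A ⊗[R] H)

variable {R H}

/-- The coaction `δ_Q = (id ⊗ π_Q) ∘ δ : A → A ⊗ Q`. -/
noncomputable def coactQuot (Q : GenQuot R H) : A →ₗ[R] A ⊗[R] Q.Carrier :=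
  Q.proj.lTensor A ∘ₗ (ComoduleAlgebra.coact (R := R) (H := H) (A := A)).toLinearMap

/-- The subalgebra `φ(Q) = A^{co Q} = {a | δ_Q(a) = a ⊗ π_Q(1)}` of `Q`-coinvariants. -/
def phi (Q : GenQuot R H) : Subalgebra R A where
  carrier := {a | coactQuot A Q a = a ⊗ₜ[R] Q.proj 1}
  mul_mem' := by
    intro a b ha hb
    simp only [Set.mem_ofPred_eq, coactQuot, LinearMap.comp_apply, AlgHom.toLinearMap_apply]
      at ha hb ⊢
    have h := lTensor_proj_mul Q (ComoduleAlgebra.coact a) (a ⊗ₜ[R] (1 : H))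
      (ComoduleAlgebra.coact b) (by rw [ha, LinearMap.lTensor_tmul])
    rw [map_mul, h]
    have h₂ : ∀ z : A ⊗[R] H, Q.proj.lTensor A (a ⊗ₜ[R] (1 : H) * z) =
        (LinearMap.mulLeft R a).rTensor Q.Carrier (Q.proj.lTensor A z) := by
      intro z
      induction z with
      | zero => simp
      | add z₁ z₂ h₁ h₂ => rw [mul_add, map_add, h₁, h₂, map_add, map_add]
      | tmul c k => simp
    rw [h₂, hb, LinearMap.rTensor_tmul, LinearMap.mulLeft_apply]
  add_mem' := by
    intro a b ha hb
    simp only [Set.mem_ofPred_eq] at ha hb ⊢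
    rw [map_add, ha, hb, TensorProduct.add_tmul]
  algebraMap_mem' := by
    intro r
    simp only [Set.mem_ofPred_eq, coactQuot, LinearMap.comp_apply, AlgHom.toLinearMap_apply,
      AlgHom.commutes, Algebra.TensorProduct.algebraMap_apply, LinearMap.lTensor_tmul]

variable {A} in
/-- `ψ(S) = ⋁ {Q | S ⊆ A^{co Q}}`, the supremum being taken in the complete lattice of generalised
quotients. -/
noncomputable def psi (S : Subalgebra R A) : GenQuot R H :=
  sSup {Q : GenQuot R H | S ≤ phi A Q}

variable {A} (H) in
/-- `S` is closed: `φ(ψ(S)) = S`. -/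
def IsClosedSubalgebra (S : Subalgebra R A) : Prop :=
  phi A (psi S : GenQuot R H) = S

/-- The cotensor product `A □_Q H ⊆ A ⊗ H`: the equaliser of `δ_Q ⊗ id` and
`id ⊗ (π_Q ⊗ id) Δ`, as maps to `A ⊗ (Q ⊗ H)`. -/
noncomputable def cotensor (Q : GenQuot R H) : Submodule R (A ⊗[R] H) :=
  LinearMap.eqLocus
    ((TensorProduct.assoc R A Q.Carrier H).toLinearMap ∘ₗ (coactQuot A Q).rTensor H)
    ((Q.proj.rTensor H ∘ₗ Coalgebra.comul (R := R) (A := H)).lTensor A)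

end Coinvariants

section Canonical

variable {R : Type u} {A : Type w} [CommRing R] [Ring A] [Algebra R A]

/-- The submodule of `S ⊗_R A` spanned by all `s b ⊗ a - s ⊗ b a` with `b ∈ B`. -/
def balancedRel {B S : Subalgebra R A} (hBS : B ≤ S) : Submodule R (S ⊗[R] A) :=
  Submodule.span R
    {x | ∃ (s : S) (b : B) (a : A),
      x = (s * Subalgebra.inclusion hBS b) ⊗ₜ[R] a - s ⊗ₜ[R] ((b : A) * a)}

/-- The tensor product `S ⊗_B A` of the right `B`-module `S` and the left `B`-module `A`, for
subalgebras `B ≤ S` of `A` (which need not be commutative). -/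
abbrev BalancedTensor {B S : Subalgebra R A} (hBS : B ≤ S) : Type w :=
  (S ⊗[R] A) ⧸ balancedRel hBS

variable (H : Type v) [Ring H] [HopfAlgebra R H] [ComoduleAlgebra R H A]

/-- The map `S ⊗_R A → A ⊗ H`, `a ⊗ b ↦ (a ⊗ 1) δ(b) = a b₍₀₎ ⊗ b₍₁₎`. -/
noncomputable def canPre (S : Subalgebra R A) : S ⊗[R] A →ₗ[R] A ⊗[R] H :=
  TensorProduct.lift ((LinearMap.mul R (A ⊗[R] H)).compl₁₂
    ((Algebra.TensorProduct.includeLeft : A →ₐ[R] A ⊗[R] H).toLinearMap ∘ₗ S.val.toLinearMap)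
    (ComoduleAlgebra.coact (R := R) (H := H) (A := A)).toLinearMap)

@[simp]
theorem canPre_tmul (S : Subalgebra R A) (s : S) (a : A) :
    canPre H S (s ⊗ₜ[R] a) = ((s : A) ⊗ₜ[R] (1 : H)) * ComoduleAlgebra.coact a := rfl

/-- The canonical map `can_S : S ⊗_B A → A ⊗ H`, `a ⊗ b ↦ a b₍₀₎ ⊗ b₍₁₎`, with `B = A^{co H}`. -/
noncomputable def can {S : Subalgebra R A} (hS : coinvariants R H A ≤ S) :
    BalancedTensor hS →ₗ[R] A ⊗[R] H :=
  (balancedRel hS).liftQ (canPre H S) <| by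
    refine Submodule.span_le.2 ?_
    rintro _ ⟨s, b, a, rfl⟩
    have hb : ComoduleAlgebra.coact (b : A) = (b : A) ⊗ₜ[R] (1 : H) := b.2
    simp only [SetLike.mem_coe, LinearMap.mem_ker, map_sub, canPre_tmul, map_mul, hb,
      MulMemClass.coe_mul, Subalgebra.coe_inclusion, ← mul_assoc,
      Algebra.TensorProduct.tmul_mul_tmul, one_mul, sub_self]

end Canonical

section CrossedProduct

variable (R : Type u) (H : Type v) (B : Type w) [CommRing R] [Ring H] [HopfAlgebra R H]
  [Ring B] [Algebra R B]

/-- The data of a crossed product `B #_σ H`: a measuring `h · b` of `B` by `H` and a normalised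
convolution invertible `2`-cocycle `σ : H ⊗ H → B` which make `B` a twisted `H`-module.  The
comultiplications are written out with representations `Δ(h) = ∑ h₍₁₎ ⊗ h₍₂₎`; all sums are
independent of the representation. -/
structure CrossedSystem where
  /-- the action `h · b` -/
  act : H →ₗ[R] B →ₗ[R] B
  /-- the cocycle -/
  σ : H ⊗[R] H →ₗ[R] B
  one_act : ∀ b : B, act 1 b = b
  act_one : ∀ h : H, act h 1 = algebraMap R B (Coalgebra.counit h)
  act_mul : ∀ (h : H) (a b : B), act h (a * b) =
    ∑ i ∈ (ℛ R h).index, act ((ℛ R h).left i) a * act ((ℛ R h).right i) b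
  isUnit_σ : IsUnit (WithConv.toConv σ)
  σ_one_left : ∀ h : H, σ (1 ⊗ₜ h) = algebraMap R B (Coalgebra.counit h)
  σ_one_right : ∀ h : H, σ (h ⊗ₜ 1) = algebraMap R B (Coalgebra.counit h)
  twisted : ∀ (h k : H) (b : B),
    ∑ i ∈ (ℛ R h).index, ∑ j ∈ (ℛ R k).index,
        act ((ℛ R h).left i) (act ((ℛ R k).left j) b) *
          σ ((ℛ R h).right i ⊗ₜ (ℛ R k).right j) =
      ∑ i ∈ (ℛ R h).index, ∑ j ∈ (ℛ R k).index,
        σ ((ℛ R h).left i ⊗ₜ (ℛ R k).left j) *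
          act ((ℛ R h).right i * (ℛ R k).right j) b
  cocycle : ∀ h k m : H,
    ∑ i ∈ (ℛ R h).index, ∑ j ∈ (ℛ R k).index, ∑ l ∈ (ℛ R m).index,
        act ((ℛ R h).left i) (σ ((ℛ R k).left j ⊗ₜ (ℛ R m).left l)) *
          σ ((ℛ R h).right i ⊗ₜ ((ℛ R k).right j * (ℛ R m).right l)) =
      ∑ i ∈ (ℛ R h).index, ∑ j ∈ (ℛ R k).index,
        σ ((ℛ R h).left i ⊗ₜ (ℛ R k).left j) *
          σ (((ℛ R h).right i * (ℛ R k).right j) ⊗ₜ m)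

variable {R H B}

/-- The product `(a # h)(b # k) = ∑ a (h₍₁₎ · b) σ(h₍₂₎ ⊗ k₍₁₎) # h₍₃₎ k₍₂₎` in `B #_σ H`, whose
underlying `R`-module is `B ⊗ H`.  Here `h₍₂₎ ⊗ h₍₃₎` is the comultiplication of the right factor
of `Δ(h)`. -/
noncomputable def CrossedSystem.mul (X : CrossedSystem R H B) (a : B) (h : H) (b : B) (k : H) :
    B ⊗[R] H :=
  ∑ i ∈ (ℛ R h).index, ∑ j ∈ (ℛ R ((ℛ R h).right i)).index, ∑ l ∈ (ℛ R k).index,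
    (a * X.act ((ℛ R h).left i) b *
        X.σ ((ℛ R ((ℛ R h).right i)).left j ⊗ₜ (ℛ R k).left l)) ⊗ₜ[R]
      ((ℛ R ((ℛ R h).right i)).right j * (ℛ R k).right l)

/-- An isomorphism `B #_σ H ≅ A` of right `H`-comodule algebras, where `B #_σ H` is the module
`B ⊗ H` with the product `CrossedSystem.mul`, the unit `1 # 1` and the coaction `id ⊗ Δ`. -/
structure CrossedProductIso (X : CrossedSystem R H B) (A : Type w') [Ring A] [Algebra R A]
    [ComoduleAlgebra R H A] where
  /-- the underlying linear isomorphism -/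
  toEquiv : B ⊗[R] H ≃ₗ[R] A
  map_one : toEquiv (1 ⊗ₜ 1) = 1
  map_mul : ∀ (a : B) (h : H) (b : B) (k : H),
    toEquiv (X.mul a h b k) = toEquiv (a ⊗ₜ h) * toEquiv (b ⊗ₜ k)
  map_coact : ∀ (b : B) (h : H),
    (ComoduleAlgebra.coact (toEquiv (b ⊗ₜ h)) : A ⊗[R] H) =
      toEquiv.toLinearMap.rTensor H
        ((TensorProduct.assoc R B H H).symm (b ⊗ₜ Coalgebra.comul (R := R) h))

/-- `A / B`, with `B = A^{co H}`, is an `H`-crossed product extension: `A ≅ B #_σ H` as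
`H`-comodule algebras for some crossed system on `B`. -/
def IsCrossedProduct (R : Type u) (H : Type v) (A : Type w) [CommRing R] [Ring H]
    [HopfAlgebra R H] [Ring A] [Algebra R A] [ComoduleAlgebra R H A] : Prop :=
  ∃ X : CrossedSystem R H (coinvariants R H A), Nonempty (CrossedProductIso X A)

end CrossedProduct

end HopfGalois

/-! Write `γ h` for the image of `1 # h` in `A`. Everything rests on the Galois map `a ⊗ h ↦ a
γ(h₍₁₎) ⊗ h₍₂₎` being a bijection of `A ⊗ H` (`galois_bijective`): on `B ⊗ H ⊗ H` it splits into a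
twist by `σ`, undone by the convolution inverse of `σ`, and a twist by multiplication of `H`, undone
by the antipode.

Since `b # h = (b # 1) γ(h)`, the module `S ⊗_B A` is covered by `S ⊗ H`, and there `can_S` is the
restriction of the Galois map (`can_toBalanced`). Flatness of `H` embeds `S ⊗ H` in `A ⊗ H`, so
`can_S` is injective with image the Galois image of `S ⊗ H`.

A second bijection of the same kind, `galoisQuot`, turns the two maps defining `A □_Q H` into `δ_Q ⊗
H` and `(a ↦ a ⊗ π_Q(1)) ⊗ H`. By flatness, `A □_Q H` is then the Galois image of `A^{co Q} ⊗ H`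
(`galois_mem_cotensor`). So the images agree iff `S ⊗ H = A^{co Q} ⊗ H` inside `A ⊗ H`, and the
counit of `H` reduces this to `S = A^{co Q}`. This works for every `Q`; the theorem is the case `Q =
ψ(S)`. -/

namespace HopfGalois

open Coalgebra TensorProduct WithConv

/-! ### Twisting by a convolution invertible map -/

section Twist

variable {R C M E : Type*} [CommRing R] [AddCommGroup C] [Module R C] [Coalgebra R C]
  [AddCommGroup M] [Module R M] [Ring E] [Algebra R E]

/-- The map `m ⊗ c ↦ f c₍₁₎ m ⊗ c₍₂₎`. -/
noncomputable def twist (f : C →ₗ[R] M →ₗ[R] M) : M ⊗[R] C →ₗ[R] M ⊗[R] C :=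
  (TensorProduct.lift f.flip).rTensor C ∘ₗ (TensorProduct.assoc R M C C).symm.toLinearMap ∘ₗ
    (comul (R := R) (A := C)).lTensor M

theorem twist_tmul (f : C →ₗ[R] M →ₗ[R] M) (m : M) (c : C) :
    twist f (m ⊗ₜ c) = (f.flip m).rTensor C (comul c) := by
  simp only [twist, LinearMap.comp_apply, LinearMap.lTensor_tmul, LinearEquiv.coe_coe]
  induction comul (R := R) c with
  | zero => simp
  | add x y hx hy => simp only [tmul_add, map_add, hx, hy]
  | tmul x y => simp

theorem rTensor_assoc_symm_lTensor_comul {P : Type*} [AddCommGroup P] [Module R P]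
    (f : C ⊗[R] C →ₗ[R] P) (c : C) :
    f.rTensor C ((TensorProduct.assoc R C C C).symm
      ((comul (R := R) (A := C)).lTensor C (comul c))) = (f ∘ₗ comul).rTensor C (comul c) := by
  rw [coassoc_symm_apply, LinearMap.rTensor_comp, LinearMap.comp_apply]

/-- The hypothesis reads `f(c₍₂₎)(g(c₍₁₎) m) = ε(c) m`; coassociativity brings this factor together
inside the composite, and the counit axiom removes it. -/
theorem twist_twist (f g : C →ₗ[R] M →ₗ[R] M)
    (h : ∀ m c, TensorProduct.lift (f.flip ∘ₗ g.flip m) (comul c) = counit (R := R) c • m)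
    (x : M ⊗[R] C) : twist f (twist g x) = x := by
  induction x with
  | zero => simp
  | add x y hx hy => simp only [map_add, hx, hy]
  | tmul m c =>
    rw [twist_tmul]
    have key : ∀ d : C ⊗[R] C, twist f ((g.flip m).rTensor C d) =
        (TensorProduct.lift (f.flip ∘ₗ g.flip m)).rTensor C ((TensorProduct.assoc R C C C).symm
          ((comul (R := R) (A := C)).lTensor C d)) := by
      intro d
      induction d with
      | zero => simp
      | add x y hx hy => simp only [map_add, hx, hy]
      | tmul x y =>
        rw [LinearMap.rTensor_tmul, twist_tmul, LinearMap.lTensor_tmul]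
        induction comul (R := R) y with
        | zero => simp
        | add x y hx hy => simp only [tmul_add, map_add, hx, hy]
        | tmul x y => simp
    rw [key, rTensor_assoc_symm_lTensor_comul]
    have h' : TensorProduct.lift (f.flip ∘ₗ g.flip m) ∘ₗ comul =
        LinearMap.toSpanSingleton R M m ∘ₗ counit := by
      ext c; simpa using h m c
    rw [h', LinearMap.rTensor_comp, LinearMap.comp_apply, rTensor_counit_comul]
    simp

/-- If `σ` is convolution invertible and `E` acts on `M` from the right, then
`m ⊗ c ↦ m σ(c₍₁₎) ⊗ c₍₂₎` is bijective. -/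
theorem twist_bijective (ρ : E →ₗ[R] M →ₗ[R] M) (ρ_one : ∀ m, ρ 1 m = m)
    (ρ_mul : ∀ x y m, ρ (x * y) m = ρ y (ρ x m)) (σ : C →ₗ[R] E) (hσ : IsUnit (toConv σ)) :
    Function.Bijective (twist (ρ ∘ₗ σ)) := by
  -- A right action reverses composition, so acting by `f` first and `g` second is acting by the
  -- convolution product `f * g`.
  have aux : ∀ f g : C →ₗ[R] E, toConv f * toConv g = 1 →
      ∀ x, twist (ρ ∘ₗ g) (twist (ρ ∘ₗ f) x) = x := by
    intro f g hfg
    refine twist_twist _ _ fun m c => ?_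
    have h := congrArg (fun t => ρ (t c) m) hfg
    simp only [LinearMap.convMul_apply, LinearMap.convOne_apply] at h
    rw [Algebra.algebraMap_eq_smul_one, map_smul, LinearMap.smul_apply, ρ_one] at h
    rw [← h]
    induction comul (R := R) c with
    | zero => simp
    | add x y hx hy => simp only [map_add, LinearMap.add_apply, hx, hy]
    | tmul x y => simp [ρ_mul]
  obtain ⟨τ, h₁, h₂⟩ := isUnit_iff_exists.1 hσ
  exact Function.bijective_iff_has_inverse.2
    ⟨twist (ρ ∘ₗ τ.ofConv), aux _ _ h₁, aux _ _ h₂⟩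

end Twist

/-! ### Twists given by multiplication in a Hopf algebra -/

section Hopf

variable {R H : Type*} [CommRing R] [Ring H] [HopfAlgebra R H]

/-- The convolution inverse of the identity is the antipode. -/
theorem isUnit_toConv_id : IsUnit (toConv (LinearMap.id : H →ₗ[R] H)) := by
  refine isUnit_iff_exists.2 ⟨toConv (HopfAlgebra.antipode R), ?_, ?_⟩
  · ext h
    simp only [LinearMap.convMul_apply, LinearMap.convOne_apply]
    exact HopfAlgebra.mul_antipode_lTensor_comul_apply h
  · ext h
    simp only [LinearMap.convMul_apply, LinearMap.convOne_apply]
    exact HopfAlgebra.mul_antipode_rTensor_comul_apply h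

/-- The right action `h ↦ (q ↦ q h)` of `H` on a generalised quotient. -/
noncomputable def GenQuot.act (Q : GenQuot R H) : H →ₗ[R] Q.Carrier →ₗ[R] Q.Carrier :=
  (Q.ker.liftQ ((LinearMap.mul R H).compr₂ Q.proj) fun x hx => LinearMap.ext fun h =>
    (Submodule.Quotient.mk_eq_zero _).2 (Q.mul_mem x hx h)).flip

theorem GenQuot.act_proj (Q : GenQuot R H) (h x : H) :
    Q.act h (Q.proj x) = Q.proj (x * h) := rfl

/-- As `ker` is a right ideal, `Q` is a right `H`-module, and the inverse is `q ⊗ h ↦ q S(h₍₁₎) ⊗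
h₍₂₎` with `S` the antipode. -/
theorem GenQuot.twist_act_bijective (Q : GenQuot R H) : Function.Bijective (twist Q.act) := by
  refine twist_bijective Q.act ?_ ?_ LinearMap.id isUnit_toConv_id
  · intro m
    obtain ⟨m, rfl⟩ := Q.ker.mkQ_surjective m
    rw [Q.act_proj, mul_one]
  · intro x y m
    obtain ⟨m, rfl⟩ := Q.ker.mkQ_surjective m
    simp only [Q.act_proj, mul_assoc]

theorem twist_mul_bijective : Function.Bijective (twist (LinearMap.mul R H).flip) :=
  twist_bijective (LinearMap.mul R H).flip (fun m => by simp) (fun x y m => by simp [mul_assoc])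
    LinearMap.id isUnit_toConv_id

end Hopf

/-! ### Crossed products and their Galois map -/

section CrossedSystem

variable {R : Type u} {H : Type v} {B : Type w} [CommRing R] [Ring H] [HopfAlgebra R H]
  [Ring B] [Algebra R B]

namespace CrossedSystem

/-- The map `g ⊗ h ↦ σ(g₍₁₎ ⊗ h₍₁₎) ⊗ g₍₂₎ h₍₂₎`, the product `(1 # g)(1 # h)`. -/
noncomputable def mulσ (X : CrossedSystem R H B) : H ⊗[R] H →ₗ[R] B ⊗[R] H :=
  TensorProduct.map X.σ (LinearMap.mul' R H) ∘ₗ comul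

theorem mulσ_tmul (X : CrossedSystem R H B) (g h : H) :
    X.mulσ (g ⊗ₜ h) = TensorProduct.map X.σ (LinearMap.mul' R H)
      (TensorProduct.tensorTensorTensorComm R H H H H (comul g ⊗ₜ comul h)) := rfl

theorem mulσ_tmul_eq_sum (X : CrossedSystem R H B) (g h : H) :
    X.mulσ (g ⊗ₜ h) = ∑ j ∈ (ℛ R g).index, ∑ l ∈ (ℛ R h).index,
      X.σ ((ℛ R g).left j ⊗ₜ (ℛ R h).left l) ⊗ₜ[R] ((ℛ R g).right j * (ℛ R h).right l) := by
  rw [mulσ_tmul, ← (ℛ R g).eq, ← (ℛ R h).eq, sum_tmul, map_sum, map_sum]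
  refine Finset.sum_congr rfl fun j _ => ?_
  rw [tmul_sum, map_sum, map_sum]
  simp

/-- Since `h · 1 = ε(h)`, the counit axiom absorbs the first of the three legs of `g`. -/
theorem mul_one_eq (X : CrossedSystem R H B) (a : B) (g h : H) :
    X.mul a g 1 h = (LinearMap.mulLeft R a).rTensor H (X.mulσ (g ⊗ₜ h)) := by
  have key : X.mul a g 1 h = ∑ i ∈ (ℛ R g).index, counit (R := R) ((ℛ R g).left i) •
      (LinearMap.mulLeft R a).rTensor H (X.mulσ ((ℛ R g).right i ⊗ₜ h)) := by
    refine Finset.sum_congr rfl fun i _ => ?_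
    simp only [mulσ_tmul_eq_sum, map_sum, Finset.smul_sum, LinearMap.rTensor_tmul, X.act_one,
      LinearMap.mulLeft_apply, ← Algebra.commutes, ← Algebra.smul_def, smul_mul_assoc, smul_tmul']
  rw [key]
  simp only [← map_smul, ← map_sum, smul_tmul', ← sum_tmul, sum_counit_smul]

theorem mulσ_one_tmul (X : CrossedSystem R H B) (h : H) : X.mulσ (1 ⊗ₜ h) = 1 ⊗ₜ h := by
  have key : ∀ z : H ⊗[R] H, TensorProduct.map X.σ (LinearMap.mul' R H)
      (TensorProduct.tensorTensorTensorComm R H H H H (((1 : H) ⊗ₜ[R] (1 : H)) ⊗ₜ z)) =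
      (Algebra.linearMap R B).rTensor H ((counit (R := R) (A := H)).rTensor H z) := by
    intro z
    induction z with
    | zero => simp
    | add x y hx hy => simp only [tmul_add, map_add, hx, hy]
    | tmul x y => simp [X.σ_one_left]
  rw [mulσ_tmul, Bialgebra.comul_one, Algebra.TensorProduct.one_def, key, rTensor_counit_comul]
  simp

/-- The coalgebra being twisted along is `H ⊗ H`, with `B` acting on itself by right multiplication.
-/
theorem twist_σ_bijective (X : CrossedSystem R H B) :
    Function.Bijective (twist ((LinearMap.mul R B).flip ∘ₗ X.σ)) :=
  twist_bijective (LinearMap.mul R B).flip (fun m => by simp) (fun x y m => by simp [mul_assoc])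
    X.σ X.isUnit_σ

end CrossedSystem

variable {A : Type w'} [Ring A] [Algebra R A] [ComoduleAlgebra R H A]

namespace CrossedProductIso

variable {X : CrossedSystem R H B} (e : CrossedProductIso X A)

/-- The cleaving map `h ↦ 1 # h`. -/
noncomputable def cleaving : H →ₗ[R] A := e.toEquiv.toLinearMap ∘ₗ TensorProduct.mk R B H 1

theorem cleaving_apply (h : H) : e.cleaving h = e.toEquiv (1 ⊗ₜ h) := rfl

theorem toEquiv_mul_cleaving (b : B) (g h : H) : e.toEquiv (b ⊗ₜ g) * e.cleaving h =
    e.toEquiv ((LinearMap.mulLeft R b).rTensor H (X.mulσ (g ⊗ₜ h))) := by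
  rw [cleaving_apply, ← e.map_mul, X.mul_one_eq]

theorem toEquiv_tmul (b : B) (h : H) :
    e.toEquiv (b ⊗ₜ h) = e.toEquiv (b ⊗ₜ 1) * e.cleaving h := by
  rw [toEquiv_mul_cleaving, X.mulσ_one_tmul, LinearMap.rTensor_tmul, LinearMap.mulLeft_apply,
    mul_one]

theorem coact_cleaving (h : H) :
    (ComoduleAlgebra.coact (e.cleaving h) : A ⊗[R] H) = e.cleaving.rTensor H (comul h) := by
  rw [cleaving_apply, e.map_coact]
  induction comul (R := R) h with
  | zero => simp
  | add x y hx hy => simp only [tmul_add, map_add, hx, hy]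
  | tmul x y => simp [cleaving_apply]

theorem toEquiv_tmul_one_mem (b : B) : e.toEquiv (b ⊗ₜ 1) ∈ coinvariants R H A := by
  change ComoduleAlgebra.coact (e.toEquiv (b ⊗ₜ 1)) = e.toEquiv (b ⊗ₜ 1) ⊗ₜ[R] (1 : H)
  rw [e.map_coact, Bialgebra.comul_one, Algebra.TensorProduct.one_def]
  simp

/-- The map `a ⊗ h ↦ a (1 # h₍₁₎) ⊗ h₍₂₎`. -/
noncomputable def galois : A ⊗[R] H →ₗ[R] A ⊗[R] H :=
  twist ((LinearMap.mul R A).flip ∘ₗ e.cleaving)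

theorem galois_tmul (a : A) (h : H) :
    e.galois (a ⊗ₜ h) = (LinearMap.mulLeft R a ∘ₗ e.cleaving).rTensor H (comul h) :=
  twist_tmul _ _ _

/-- Both sides send `b ⊗ g ⊗ h` to `b σ(g₍₁₎ ⊗ h₍₁₎) # g₍₂₎ h₍₂₎ ⊗ h₍₃₎`. -/
theorem galois_toEquiv (x : B ⊗[R] (H ⊗[R] H)) :
    e.galois (e.toEquiv.toLinearMap.rTensor H ((TensorProduct.assoc R B H H).symm x)) =
      e.toEquiv.toLinearMap.rTensor H ((TensorProduct.assoc R B H H).symm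
        ((twist (LinearMap.mul R H).flip).lTensor B
          (twist ((LinearMap.mul R B).flip ∘ₗ X.σ) x))) := by
  induction x with
  | zero => simp
  | add x y hx hy => simp only [map_add, hx, hy]
  | tmul b z =>
    induction z with
    | zero => simp
    | add x y hx hy => simp only [tmul_add, map_add, hx, hy]
    | tmul g h =>
      let T : (H ⊗[R] H) ⊗[R] (H ⊗[R] H) →ₗ[R] A := e.toEquiv.toLinearMap ∘ₗ
        (LinearMap.mulLeft R b).rTensor H ∘ₗ TensorProduct.map X.σ (LinearMap.mul' R H) ∘ₗ
          (TensorProduct.tensorTensorTensorComm R H H H H).toLinearMap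
      have hT : LinearMap.mulLeft R (e.toEquiv (b ⊗ₜ g)) ∘ₗ e.cleaving =
          (T ∘ₗ TensorProduct.mk R _ _ (comul g)) ∘ₗ comul :=
        LinearMap.ext fun x => e.toEquiv_mul_cleaving b g x
      rw [_root_.TensorProduct.assoc_symm_tmul, LinearMap.rTensor_tmul, LinearEquiv.coe_coe,
        galois_tmul, hT,
        ← rTensor_assoc_symm_lTensor_comul, twist_tmul, TensorProduct.comul_tmul]
      -- With `Δ(h)` and `Δ(g)` replaced by arbitrary tensors `c` and `d`, the identity is linear in
      -- each and can be checked on pure tensors.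
      have key : ∀ c d : H ⊗[R] H, (T ∘ₗ TensorProduct.mk R _ _ d).rTensor H
          ((TensorProduct.assoc R H H H).symm ((comul (R := R) (A := H)).lTensor H c)) =
          e.toEquiv.toLinearMap.rTensor H ((TensorProduct.assoc R B H H).symm
            ((twist (LinearMap.mul R H).flip).lTensor B
              ((((LinearMap.mul R B).flip ∘ₗ X.σ).flip b).rTensor (H ⊗[R] H)
                (TensorProduct.tensorTensorTensorComm R H H H H (d ⊗ₜ c))))) := by
        intro c d
        induction d with
        | zero => simp
        | add x y hx hy =>
          simp only [add_tmul, map_add, LinearMap.comp_add, LinearMap.rTensor_add,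
            LinearMap.add_apply, hx, hy]
        | tmul g₁ g₂ =>
          induction c with
          | zero => simp
          | add x y hx hy => simp only [tmul_add, map_add, hx, hy]
          | tmul x y =>
            simp only [LinearMap.lTensor_tmul, tensorTensorTensorComm_tmul,
              LinearMap.rTensor_tmul, twist_tmul]
            induction comul (R := R) y with
            | zero => simp
            | add x y hx hy => simp only [tmul_add, map_add, hx, hy]
            | tmul y z => simp [T]
      exact key _ _

theorem galois_bijective : Function.Bijective e.galois := by
  let E : B ⊗[R] (H ⊗[R] H) ≃ₗ[R] A ⊗[R] H :=
    (TensorProduct.assoc R B H H).symm ≪≫ₗ LinearEquiv.rTensor H e.toEquiv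
  let F : B ⊗[R] (H ⊗[R] H) ≃ₗ[R] B ⊗[R] (H ⊗[R] H) :=
    LinearEquiv.ofBijective _ X.twist_σ_bijective ≪≫ₗ
      LinearEquiv.lTensor B (LinearEquiv.ofBijective _ twist_mul_bijective)
  have h : ⇑e.galois = E ∘ F ∘ E.symm := by
    funext x
    obtain ⟨x, rfl⟩ := E.surjective x
    simp only [Function.comp_apply, LinearEquiv.symm_apply_apply]
    exact e.galois_toEquiv x
  rw [h]
  exact E.bijective.comp (F.bijective.comp E.symm.bijective)

end CrossedProductIso

end CrossedSystem

/-- Applying `id ⊗ ε` to the image of `S ⊗ H` gives back exactly `S`, because `ε(1) = 1`. -/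
theorem eq_of_range_rTensor_val_eq {R H A : Type*} [CommRing R] [Ring H] [HopfAlgebra R H]
    [Ring A] [Algebra R A] {S T : Subalgebra R A}
    (h : LinearMap.range (S.val.toLinearMap.rTensor H) =
      LinearMap.range (T.val.toLinearMap.rTensor H)) : S = T := by
  have key : ∀ S : Subalgebra R A, Subalgebra.toSubmodule S =
      (LinearMap.range (S.val.toLinearMap.rTensor H)).map
        ((TensorProduct.rid R A).toLinearMap ∘ₗ (counit (R := R) (A := H)).lTensor A) := by
    intro S
    apply le_antisymm
    · intro s hs
      exact ⟨s ⊗ₜ 1, ⟨⟨s, hs⟩ ⊗ₜ 1, rfl⟩, by simp⟩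
    · rintro _ ⟨_, ⟨t, rfl⟩, rfl⟩
      induction t with
      | zero => simp
      | add x y hx hy => simp only [map_add]; exact add_mem hx hy
      | tmul s h => simpa using S.smul_mem s.2 _
  apply Subalgebra.toSubmodule_injective
  rw [key S, key T, h]

/-! ### The cotensor product through the Galois map -/

section Cotensor

variable {R : Type u} {H : Type v} {B : Type w} {A : Type w'} [CommRing R] [Ring H]
  [HopfAlgebra R H] [Ring B] [Algebra R B] [Ring A] [Algebra R A] [ComoduleAlgebra R H A]
  {X : CrossedSystem R H B} (e : CrossedProductIso X A) (Q : GenQuot R H)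

namespace CrossedProductIso

/-- The map `(a ⊗ q) ⊗ h ↦ a (1 # h₍₁₎) ⊗ (q h₍₂₎ ⊗ h₍₃₎)`. -/
noncomputable def galoisQuot : (A ⊗[R] Q.Carrier) ⊗[R] H ≃ₗ[R] A ⊗[R] (Q.Carrier ⊗[R] H) :=
  TensorProduct.rightComm R A Q.Carrier H ≪≫ₗ
    LinearEquiv.rTensor Q.Carrier (LinearEquiv.ofBijective _ e.galois_bijective) ≪≫ₗ
    TensorProduct.rightComm R A H Q.Carrier ≪≫ₗ TensorProduct.assoc R A Q.Carrier H ≪≫ₗ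
    LinearEquiv.lTensor A (LinearEquiv.ofBijective _ Q.twist_act_bijective)

theorem galoisQuot_tmul (a : A) (q : Q.Carrier) (h : H) :
    e.galoisQuot Q ((a ⊗ₜ q) ⊗ₜ h) =
      TensorProduct.map (LinearMap.mulLeft R a ∘ₗ e.cleaving)
        (twist Q.act ∘ₗ TensorProduct.mk R _ _ q) (comul h) := by
  have key : ∀ z : H ⊗[R] H, (twist Q.act).lTensor A (TensorProduct.assoc R A Q.Carrier H
      (TensorProduct.rightComm R A H Q.Carrier
        ((LinearMap.mulLeft R a ∘ₗ e.cleaving).rTensor H z ⊗ₜ q))) =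
      TensorProduct.map (LinearMap.mulLeft R a ∘ₗ e.cleaving)
        (twist Q.act ∘ₗ TensorProduct.mk R _ _ q) z := by
    intro z
    induction z with
    | zero => simp
    | add x y hx hy => simp only [add_tmul, map_add, hx, hy]
    | tmul x y => simp
  rw [← key, ← galois_tmul]
  rfl

/-- Both sides are `a γ(h₍₁₎) ⊗ π_Q(h₍₂₎) ⊗ h₍₃₎`, as `π_Q(h) = π_Q(1) h`. -/
theorem lTensor_comul_galois (a : A) (h : H) :
    ((Q.proj.rTensor H ∘ₗ comul (R := R) (A := H)).lTensor A) (e.galois (a ⊗ₜ h)) =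
      e.galoisQuot Q ((a ⊗ₜ Q.proj 1) ⊗ₜ h) := by
  rw [galoisQuot_tmul, galois_tmul]
  induction comul (R := R) h with
  | zero => simp
  | add x y hx hy => simp only [map_add, hx, hy]
  | tmul x y =>
    simp only [LinearMap.rTensor_tmul, LinearMap.lTensor_tmul, _root_.TensorProduct.map_tmul,
      LinearMap.comp_apply, mk_apply, twist_tmul]
    have hQ : Q.proj = Q.act.flip (Q.proj 1) :=
      LinearMap.ext fun y => by rw [LinearMap.flip_apply, Q.act_proj, one_mul]
    rw [← hQ]

/-- Colinearity of `γ` gives `a γ(h₍₁₎) ⊗ π_Q(k h₍₂₎) ⊗ h₍₃₎` for `z = a ⊗ k`. A general `z` is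
allowed because the intended value, `δ(a)`, is not a pure tensor. -/
theorem galoisQuot_proj (z : A ⊗[R] H) (h : H) :
    TensorProduct.assoc R A Q.Carrier H
      ((Q.proj.lTensor A ∘ₗ LinearMap.mulLeft R z ∘ₗ
        (ComoduleAlgebra.coact (R := R) (H := H) (A := A)).toLinearMap ∘ₗ
          e.cleaving).rTensor H (comul h)) =
      e.galoisQuot Q (Q.proj.lTensor A z ⊗ₜ h) := by
  have hc : (ComoduleAlgebra.coact (R := R) (H := H) (A := A)).toLinearMap ∘ₗ e.cleaving =
      e.cleaving.rTensor H ∘ₗ comul := LinearMap.ext e.coact_cleaving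
  rw [hc, ← LinearMap.comp_assoc, ← LinearMap.comp_assoc, ← rTensor_assoc_symm_lTensor_comul]
  induction z with
  | zero => simp
  | add x y hx hy =>
    have hadd : LinearMap.mulLeft R (x + y) = LinearMap.mulLeft R x + LinearMap.mulLeft R y :=
      map_add (LinearMap.mul R (A ⊗[R] H)) x y
    rw [hadd, LinearMap.comp_add, LinearMap.add_comp, LinearMap.rTensor_add, LinearMap.add_apply,
      map_add, hx, hy, map_add, add_tmul, map_add]
  | tmul a k =>
    rw [LinearMap.lTensor_tmul, galoisQuot_tmul]
    induction comul (R := R) h with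
    | zero => simp
    | add x y hx hy => simp only [map_add, hx, hy]
    | tmul x y =>
      simp only [LinearMap.lTensor_tmul, _root_.TensorProduct.map_tmul,
        LinearMap.comp_apply, mk_apply, twist_tmul]
      induction comul (R := R) y with
      | zero => simp
      | add x y hx hy => simp only [tmul_add, map_add, hx, hy]
      | tmul y z =>
        simp only [_root_.TensorProduct.assoc_symm_tmul, LinearMap.rTensor_tmul,
          LinearMap.comp_apply, LinearMap.mulLeft_apply, Algebra.TensorProduct.tmul_mul_tmul,
          LinearMap.lTensor_tmul, TensorProduct.assoc_tmul, LinearMap.flip_apply, Q.act_proj]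

theorem rTensor_coactQuot_galois (a : A) (h : H) :
    TensorProduct.assoc R A Q.Carrier H ((coactQuot A Q).rTensor H (e.galois (a ⊗ₜ h))) =
      e.galoisQuot Q (coactQuot A Q a ⊗ₜ h) := by
  have hc : Q.proj.lTensor A ∘ₗ LinearMap.mulLeft R (ComoduleAlgebra.coact a) ∘ₗ
      (ComoduleAlgebra.coact (R := R) (H := H) (A := A)).toLinearMap ∘ₗ e.cleaving =
      coactQuot A Q ∘ₗ LinearMap.mulLeft R a ∘ₗ e.cleaving :=
    LinearMap.ext fun x => by simp [coactQuot]
  have h₁ := e.galoisQuot_proj Q (ComoduleAlgebra.coact a) h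
  rw [hc] at h₁
  rw [galois_tmul, ← LinearMap.comp_apply, ← LinearMap.rTensor_comp, h₁]
  rfl

theorem galois_mem_cotensor [Module.Flat R H] (t : A ⊗[R] H) :
    e.galois t ∈ cotensor A Q ↔
      t ∈ LinearMap.range ((phi A Q).val.toLinearMap.rTensor H) := by
  -- The kernel of `d` is `A^{co Q}`, so flatness of `H` makes the image of `A^{co Q} ⊗ H` the
  -- kernel of `d ⊗ H`.
  let d : A →ₗ[R] A ⊗[R] Q.Carrier :=
    coactQuot A Q - (TensorProduct.mk R A Q.Carrier).flip (Q.proj 1)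
  have hex : Function.Exact (phi A Q).val.toLinearMap d := by
    intro a
    rw [LinearMap.sub_apply, sub_eq_zero]
    exact ⟨fun h => ⟨⟨a, h⟩, rfl⟩, by rintro ⟨b, rfl⟩; exact b.2⟩
  have key : ∀ t : A ⊗[R] H, TensorProduct.assoc R A Q.Carrier H
        ((coactQuot A Q).rTensor H (e.galois t)) -
      ((Q.proj.rTensor H ∘ₗ comul (R := R) (A := H)).lTensor A) (e.galois t) =
      e.galoisQuot Q (d.rTensor H t) := by
    intro t
    induction t with
    | zero => simp
    | add x y hx hy => simp only [map_add, ← hx, ← hy]; abel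
    | tmul a h =>
      rw [rTensor_coactQuot_galois, lTensor_comul_galois, ← map_sub, ← sub_tmul]
      rfl
  refine Iff.trans ?_ (Module.Flat.rTensor_exact H hex t)
  rw [← (e.galoisQuot Q).map_eq_zero_iff, ← key, sub_eq_zero]
  rfl

end CrossedProductIso

end Cotensor

/-! ### Comparing the image of the canonical map with the cotensor product -/

section Main

variable {R : Type u} {H : Type v} {A : Type w} [CommRing R] [Ring H] [HopfAlgebra R H]
  [Ring A] [Algebra R A] [ComoduleAlgebra R H A]

namespace CrossedProductIso

variable {B : Type w'} [Ring B] [Algebra R B] {X : CrossedSystem R H B}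
  (e : CrossedProductIso X A)

variable {S : Subalgebra R A} (hS : coinvariants R H A ≤ S)

/-- The map `S ⊗ H → S ⊗_B A`, `s ⊗ h ↦ s ⊗ (1 # h)`. -/
noncomputable def toBalanced : S ⊗[R] H →ₗ[R] BalancedTensor hS :=
  (balancedRel hS).mkQ ∘ₗ e.cleaving.lTensor S

theorem can_toBalanced (t : S ⊗[R] H) :
    can H hS (e.toBalanced hS t) = e.galois (S.val.toLinearMap.rTensor H t) := by
  induction t with
  | zero => simp
  | add x y hx hy => simp only [map_add, hx, hy]
  | tmul s h =>
    change ((s : A) ⊗ₜ[R] (1 : H)) * ComoduleAlgebra.coact (e.cleaving h) = e.galois ((s : A) ⊗ₜ h)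
    rw [coact_cleaving, galois_tmul]
    induction comul (R := R) h with
    | zero => simp
    | add x y hx hy => simp only [mul_add, map_add, hx, hy]
    | tmul x y => simp

/-- In `S ⊗_B A` the factor `b # 1` of `b # h = (b # 1) γ(h)` is coinvariant and moves across to
`S`. -/
theorem toBalanced_surjective : Function.Surjective (e.toBalanced hS) := by
  intro x
  obtain ⟨z, rfl⟩ := (balancedRel hS).mkQ_surjective x
  change _ ∈ LinearMap.range (e.toBalanced hS)
  induction z with
  | zero => rw [map_zero]; exact zero_mem _
  | add x y hx hy => rw [map_add]; exact add_mem hx hy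
  | tmul s a =>
    obtain ⟨x, rfl⟩ := e.toEquiv.surjective a
    induction x with
    | zero => rw [map_zero, tmul_zero, map_zero]; exact zero_mem _
    | add x y hx hy => rw [map_add, tmul_add, map_add]; exact add_mem hx hy
    | tmul b h =>
      let c : coinvariants R H A := ⟨e.toEquiv (b ⊗ₜ 1), e.toEquiv_tmul_one_mem b⟩
      refine ⟨(s * Subalgebra.inclusion hS c) ⊗ₜ h, (Submodule.Quotient.eq _).2 ?_⟩
      rw [e.toEquiv_tmul]
      exact Submodule.subset_span ⟨s, c, e.cleaving h, rfl⟩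

/-- For every generalised quotient `Q`, the subalgebra `S` is `A^{co Q}` if and only if `can_S` is
an isomorphism onto `A □_Q H`. -/
theorem phi_eq_iff_can_bijOn (e : CrossedProductIso X A) [Module.Flat R H] (Q : GenQuot R H) :
    phi A Q = S ↔ Set.BijOn (can H hS) Set.univ (cotensor A Q) := by
  -- The composite with the surjection from `S ⊗ H` is injective, being the inclusion into `A ⊗ H`
  -- followed by the Galois map; hence so is `can_S`.
  have hinj : Function.Injective (can H hS) := by
    have h : Function.Injective (can H hS ∘ e.toBalanced hS) := by
      have h₁ : ⇑(can H hS) ∘ e.toBalanced hS = e.galois ∘ S.val.toLinearMap.rTensor H :=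
        funext (e.can_toBalanced hS)
      rw [h₁]
      exact e.galois_bijective.injective.comp
        (Module.Flat.rTensor_preserves_injective_linearMap _ Subtype.val_injective)
    exact Function.Injective.of_comp_right h (e.toBalanced_surjective hS)
  have hrange : LinearMap.range (can H hS) =
      (LinearMap.range (S.val.toLinearMap.rTensor H)).map e.galois := by
    rw [← LinearMap.range_comp, ← LinearMap.range_comp_of_range_eq_top (can H hS)
      (LinearMap.range_eq_top.2 (e.toBalanced_surjective hS))]
    exact congrArg LinearMap.range (LinearMap.ext (e.can_toBalanced hS))
  have hcot : cotensor A Q =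
      (LinearMap.range ((phi A Q).val.toLinearMap.rTensor H)).map e.galois := by
    ext x
    obtain ⟨t, rfl⟩ := e.galois_bijective.surjective x
    rw [galois_mem_cotensor, Submodule.mem_map]
    exact ⟨fun h => ⟨t, h, rfl⟩, fun ⟨s, hs, h⟩ => e.galois_bijective.injective h ▸ hs⟩
  have hbij : Set.BijOn (can H hS) Set.univ (cotensor A Q) ↔
      LinearMap.range (can H hS) = cotensor A Q := by
    rw [← SetLike.coe_set_eq, LinearMap.coe_range, ← Set.image_univ]
    exact ⟨fun h => h.image_eq, fun h => h ▸ hinj.injOn.bijOn_image⟩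
  rw [hbij, hrange, hcot,
    (Submodule.map_injective_of_injective e.galois_bijective.injective).eq_iff]
  exact ⟨fun h => by rw [h], fun h => (eq_of_range_rTensor_val_eq h).symm⟩

end CrossedProductIso

end Main

end HopfGalois

theorem mainTheorem8 (R : Type u) (H : Type v) (A : Type w) [CommRing R]
    [Ring H] [HopfAlgebra R H] [Ring A] [Algebra R A] [HopfGalois.ComoduleAlgebra R H A]
    (hA : HopfGalois.IsCrossedProduct R H A)
    (hBff : Module.FaithfullyFlat R (HopfGalois.coinvariants R H A))
    (hBml : HopfGalois.IsMittagLeffler R (HopfGalois.coinvariants R H A))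
    (hH : Module.Flat R H)
    (S : Subalgebra R A) (hS : HopfGalois.coinvariants R H A ≤ S) :
    HopfGalois.IsClosedSubalgebra H S ↔
      Set.BijOn (HopfGalois.can H hS) Set.univ
        (HopfGalois.cotensor A (HopfGalois.psi S : HopfGalois.GenQuot R H)) := by
  obtain ⟨X, ⟨e⟩⟩ := hA
  exact e.phi_eq_iff_can_bijOn hS (HopfGalois.psi S)
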